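/- Let $a,n\ge 1$ be integers, $\mu\in\mathbb R$, $\sigma^2>0$ and $\sigma_\alpha^2\ge 0$. Consider the one-way random effects model \[ y_{ij}=\mu+\alpha_i+e_{ij},\qquad i=1,\dots,a,\ j=1,\dots,n, \] where $\alpha_i\sim N(0,\sigma_\alpha^2)$, $e_{ij}\sim N(0,\sigma^2)$, and all the random variables $\alpha_i$ and $e_{ij}$ are mutually independent. Let $\bar y_{i.}=\frac1n\sum_j y_{ij}$, $\bar y_{..}=\frac1{an}\sum_{i,j}y_{ij}$, and \[ SS_A=\sum_{i=1}^a\sum_{j=1}^n(\bar y_{i.}-\bar y_{..})^2,\qquad SS_E=\sum_{i=1}^a\sum_{j=1}^n(y_{ij}-\bar y_{i.})^2 . \] Write $\chi^2(k)$ for the law of the sum of squares of $k$ independent standard normal variables (the point mass at $0$ if $k=0$), $F(d_1,d_2)$ for the law of $(U/d_1)/(V/d_2)$ with $U\sim\chi^2(d_1)$ and $V\sim\chi^2(d_2)$ independent, and $c\,\nu$ for the law of $cX$ when $X\sim\nu$. Then $SS_A$ and $SS_E$ are independent, and \[ SS_A\sim(\sigma^2+n\sigma_\alpha^2)\,\chi^2(a-1),\qquad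 SS_E\sim\sigma^2\,\chi^2(a(n-1)). \] If moreover $a\ge2$ and $n\ge2$, then with $MS_A=SS_A/(a-1)$ and $MS_E=SS_E/[a(n-1)]$, \[ F_A=\frac{MS_A}{MS_E}\sim\frac{\sigma^2+n\sigma_\alpha^2}{\sigma^2}\,F(a-1,a(n-1)). \] -/

import Mathlib

open MeasureTheory ProbabilityTheory
open scoped NNReal

namespace OneWayAnova

/-- The (central) chi-square distribution with `k` degrees of freedom: the law of
`Z₁² + ⋯ + Z_k²` for independent standard normal `Z₁, …, Z_k`. For `k = 0` this is the
point mass at `0`. -/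
noncomputable def chiSquare (k : ℕ) : Measure ℝ :=
  (Measure.pi (fun _ : Fin k => gaussianReal 0 1)).map (fun z => ∑ i, z i ^ 2)

/-- The (central) `F` distribution with `d₁` and `d₂` degrees of freedom: the law of
`(U / d₁) / (V / d₂)` for independent `U ~ χ²(d₁)` and `V ~ χ²(d₂)`.
Meaningful for `d₁, d₂ ≥ 1`. -/
noncomputable def fDist (d₁ d₂ : ℕ) : Measure ℝ :=
  ((chiSquare d₁).prod (chiSquare d₂)).map (fun p => (p.1 / d₁) / (p.2 / d₂))

/-- The law of `c * X` when `X` has law `ν`. -/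
noncomputable def scaled (c : ℝ) (ν : Measure ℝ) : Measure ℝ :=
  ν.map (fun x => c * x)

variable {a n : ℕ}

/-- The group mean `ȳ_{i.}`. -/
noncomputable def groupMean (y : Fin a → Fin n → ℝ) (i : Fin a) : ℝ :=
  (∑ j, y i j) / n

/-- The overall mean `ȳ_{..}`. -/
noncomputable def grandMean (y : Fin a → Fin n → ℝ) : ℝ :=
  (∑ i, ∑ j, y i j) / ((a : ℝ) * n)

/-- The sum of squares due to factor `A`. -/
noncomputable def SSA (y : Fin a → Fin n → ℝ) : ℝ :=
  ∑ i : Fin a, ∑ _j : Fin n, (groupMean y i - grandMean y) ^ 2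

/-- The error sum of squares. -/
noncomputable def SSE (y : Fin a → Fin n → ℝ) : ℝ :=
  ∑ i : Fin a, ∑ j : Fin n, (y i j - groupMean y i) ^ 2

/-- The mean sum of squares due to factor `A`. -/
noncomputable def MSA (y : Fin a → Fin n → ℝ) : ℝ :=
  SSA y / ((a : ℝ) - 1)

/-- The error mean sum of squares. -/
noncomputable def MSE (y : Fin a → Fin n → ℝ) : ℝ :=
  SSE y / ((a : ℝ) * ((n : ℝ) - 1))

/-- The test statistic `F_A`. -/
noncomputable def FA (y : Fin a → Fin n → ℝ) : ℝ :=
  MSA y / MSE y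

/-- The one-way random effects model `y i j = μ + α i + e i j`, with `α i ~ N(0, σαsq)`,
`e i j ~ N(0, σsq)` and all the `α i` and `e i j` mutually independent. -/
structure RandomEffectsModel {Ω : Type*} [MeasurableSpace Ω] (P : Measure Ω)
    (μ : ℝ) (σsq σαsq : ℝ≥0) (α : Fin a → Ω → ℝ) (e y : Fin a → Fin n → Ω → ℝ) : Prop where
  effect_law : ∀ i, HasLaw (α i) (gaussianReal 0 σαsq) P
  error_law : ∀ i j, HasLaw (e i j) (gaussianReal 0 σsq) P
  indep : iIndepFun (Sum.elim α (fun p : Fin a × Fin n => e p.1 p.2)) P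
  response : ∀ i j ω, y i j ω = μ + α i ω + e i j ω

end OneWayAnova

open OneWayAnova

/-!
Stack the responses into a Gaussian vector `Y` of the Euclidean space of `a × n` arrays. Its mean
is constant, and its covariance form is `σ²⟪u, v⟫ + σ_α² ∑ᵢ (∑ⱼ uᵢⱼ) (∑ⱼ vᵢⱼ)`. `SS_A` and `SS_E`
are the squared norms of the projections of `Y` onto two orthogonal subspaces: the arrays that are
constant on groups with total zero (dimension `a - 1`), and the arrays with vanishing group totals
(dimension `a (n - 1)`). Both are orthogonal to the mean, the covariance form is
`σ² + n σ_α²` times the inner product on the first, `σ²` times it on the second, and vanishes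
between the two. Hence the projections are independent, centred and isotropic.
-/

namespace OneWayAnova

open Module

open scoped RealInnerProductSpace

lemma hasGaussianLaw_const_add {F Ω : Type*} [NormedAddCommGroup F] [NormedSpace ℝ F]
    [MeasurableSpace F] [BorelSpace F] [SecondCountableTopology F] [MeasurableSpace Ω]
    {P : Measure Ω} {X : Ω → F} (hX : HasGaussianLaw X P) (c : F) :
    HasGaussianLaw (fun ω => c + X ω) P := by
  have := hX.isGaussian_map
  have hmap : P.map (fun ω => c + X ω) = (P.map X).map (c + ·) :=
    (AEMeasurable.map_map_of_aemeasurable (by fun_prop) hX.aemeasurable).symm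
  exact ⟨hmap ▸ inferInstance⟩

instance (k : ℕ) : IsProbabilityMeasure (chiSquare k) :=
  Measure.isProbabilityMeasure_map (Measurable.aemeasurable (by fun_prop))

instance (c : ℝ) (ν : Measure ℝ) [IsProbabilityMeasure ν] : IsProbabilityMeasure (scaled c ν) :=
  Measure.isProbabilityMeasure_map (by fun_prop)

section GaussianVector

variable {E : Type*} [NormedAddCommGroup E] [InnerProductSpace ℝ E] [FiniteDimensional ℝ E]
  [MeasurableSpace E] [BorelSpace E]

lemma map_norm_sq_stdGaussian :
    (stdGaussian E).map (fun x => ‖x‖ ^ 2) = chiSquare (finrank ℝ E) := by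
  let b := stdOrthonormalBasis ℝ E
  have norm_sq_sum (z : Fin (finrank ℝ E) → ℝ) : ‖∑ i, z i • b i‖ ^ 2 = ∑ i, z i ^ 2 := by
    simp only [← b.sum_sq_inner_right, b.orthonormal.inner_right_fintype]
  rw [stdGaussian, Measure.map_map (by fun_prop) (by fun_prop), chiSquare]
  exact congrArg (Measure.map · _) (funext norm_sq_sum)

lemma eq_map_smul_stdGaussian {ν : Measure E} [IsGaussian ν] {s : ℝ≥0} (hmean : ν[id] = 0)
    (hcov : ∀ u v, covarianceBilin ν u v = s * ⟪u, v⟫) :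
    ν = (stdGaussian E).map (fun x => √s • x) := by
  let L : E →L[ℝ] E := √s • ContinuousLinearMap.id ℝ E
  change ν = (stdGaussian E).map L
  refine IsGaussian.ext ?_ ?_
  · simp only [id_eq] at hmean
    simp only [id_eq, hmean, L.integral_id_map IsGaussian.integrable_id, integral_id_stdGaussian,
      map_zero]
  · ext u v
    rw [covarianceBilin_map IsGaussian.memLp_two_id, covarianceBilin_stdGaussian, hcov]
    have hL : L.adjoint = L :=
      ((ContinuousLinearMap.eq_adjoint_iff L L).2 fun x y => by
        simp only [L, smul_apply, ContinuousLinearMap.id_apply,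
          real_inner_smul_left, real_inner_smul_right]).symm
    rw [hL]
    change _ = ⟪√(s : ℝ) • u, √(s : ℝ) • v⟫
    rw [real_inner_smul_left, real_inner_smul_right, ← mul_assoc,
      Real.mul_self_sqrt s.coe_nonneg]

variable {Ω : Type*} [MeasurableSpace Ω] {P : Measure Ω} {X : Ω → E}

lemma hasLaw_norm_sq_of_isotropic (hX : HasGaussianLaw X P) {s : ℝ≥0} (hmean : P[X] = 0)
    (hcov : ∀ u v, covarianceBilin (P.map X) u v = s * ⟪u, v⟫) :
    HasLaw (fun ω => ‖X ω‖ ^ 2) (scaled s (chiSquare (finrank ℝ E))) P := by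
  have := hX.isGaussian_map
  have hXlaw : HasLaw X ((stdGaussian E).map fun x => √s • x) P :=
    ⟨hX.aemeasurable, eq_map_smul_stdGaussian
      (by rwa [integral_map hX.aemeasurable (by fun_prop)]) hcov⟩
  refine HasLaw.fun_comp (Y := fun x : E => ‖x‖ ^ 2) ⟨by fun_prop, ?_⟩ hXlaw
  rw [← map_norm_sq_stdGaussian, scaled, Measure.map_map (by fun_prop) (by fun_prop),
    Measure.map_map (by fun_prop) (by fun_prop)]
  congr 1
  ext x
  simp [norm_smul, mul_pow]

lemma hasLaw_norm_sq_orthogonalProjectionOnto (hX : HasGaussianLaw X P) {s : ℝ≥0}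
    {S : Submodule ℝ E} (hmean : P[X] ∈ Sᗮ)
    (hcov : ∀ u ∈ S, ∀ v ∈ S, covarianceBilin (P.map X) u v = s * ⟪u, v⟫) :
    HasLaw (fun ω => ‖S.orthogonalProjectionOnto (X ω)‖ ^ 2)
      (scaled s (chiSquare (finrank ℝ S))) P := by
  have := hX.isGaussian_map
  refine hasLaw_norm_sq_of_isotropic (hX.map_fun S.orthogonalProjectionOnto) ?_ fun u v => ?_
  · rw [ContinuousLinearMap.integral_comp_comm _ hX.integrable]
    exact Submodule.orthogonalProjectionOnto_eq_zero_iff.2 hmean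
  · have hmap : P.map (fun ω => S.orthogonalProjectionOnto (X ω))
        = (P.map X).map S.orthogonalProjectionOnto :=
      (AEMeasurable.map_map_of_aemeasurable (by fun_prop) hX.aemeasurable).symm
    rw [hmap, covarianceBilin_map IsGaussian.memLp_two_id,
      Submodule.adjoint_orthogonalProjectionOnto]
    exact hcov u u.2 v v.2

lemma indepFun_orthogonalProjectionOnto (hX : HasGaussianLaw X P) {S T : Submodule ℝ E}
    (hcov : ∀ u ∈ S, ∀ v ∈ T, covarianceBilin (P.map X) u v = 0) :
    IndepFun (fun ω => S.orthogonalProjectionOnto (X ω))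
      (fun ω => T.orthogonalProjectionOnto (X ω)) P := by
  have := hX.isGaussian_map
  have hpair : HasGaussianLaw
      (fun ω => (S.orthogonalProjectionOnto (X ω), T.orthogonalProjectionOnto (X ω))) P :=
    hX.map_fun (S.orthogonalProjectionOnto.prod T.orthogonalProjectionOnto)
  refine hpair.indepFun_of_covariance_inner fun u v => ?_
  simp only [Submodule.inner_orthogonalProjectionOnto_eq_of_mem_left]
  have h := hcov u u.2 v v.2
  rwa [covarianceBilin_apply_eq_cov IsGaussian.memLp_two_id,
    covariance_map (by fun_prop) (by fun_prop) hX.aemeasurable] at h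

end GaussianVector

lemma map_ratio_prod_scaled (c s : ℝ) (d₁ d₂ : ℕ) :
    ((scaled c (chiSquare d₁)).prod (scaled s (chiSquare d₂))).map
      (fun p : ℝ × ℝ => (p.1 / d₁) / (p.2 / d₂)) = scaled (c / s) (fDist d₁ d₂) := by
  rw [scaled, scaled, Measure.map_prod_map _ _ (by fun_prop) (by fun_prop),
    Measure.map_map (by fun_prop) (by fun_prop), scaled, fDist,
    Measure.map_map (by fun_prop) (by fun_prop)]
  congr 1
  ext p
  simp only [Function.comp_apply, Prod.map_fst, Prod.map_snd]
  ring

lemma hasLaw_ratio_of_indepFun {Ω : Type*} [MeasurableSpace Ω] {P : Measure Ω}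
    {U V : Ω → ℝ} {c s : ℝ} {d₁ d₂ : ℕ} (hUV : IndepFun U V P)
    (hU : HasLaw U (scaled c (chiSquare d₁)) P) (hV : HasLaw V (scaled s (chiSquare d₂)) P) :
    HasLaw (fun ω => (U ω / d₁) / (V ω / d₂)) (scaled (c / s) (fDist d₁ d₂)) P := by
  have := hU.isProbabilityMeasure
  exact HasLaw.fun_comp (Y := fun p : ℝ × ℝ => (p.1 / d₁) / (p.2 / d₂))
    ⟨by fun_prop, map_ratio_prod_scaled c s d₁ d₂⟩ (hUV.hasLaw_prod hU hV)

section TwoWayArrays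

variable {ι κ : Type*}

/-- The two-way array whose entries in the group `i` are all equal to `c i`, as a linear function of
`c`. Group means and effects enter the Euclidean space of arrays through it. -/
noncomputable def constOnGroups (κ : Type*) : (ι → ℝ) →ₗ[ℝ] EuclideanSpace ℝ (ι × κ) where
  toFun c := WithLp.toLp 2 fun p => c p.1
  map_add' _ _ := rfl
  map_smul' _ _ := rfl

lemma constOnGroups_apply (c : ι → ℝ) (p : ι × κ) : constOnGroups κ c p = c p.1 :=
  rfl

section FintypeGroup

variable [Fintype κ]

/-- The vector of group totals of a two-way array; the group is the first index. -/
noncomputable def groupSum : EuclideanSpace ℝ (ι × κ) →ₗ[ℝ] (ι → ℝ) where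
  toFun u i := ∑ j, u (i, j)
  map_add' u v := by ext i; simp [Finset.sum_add_distrib]
  map_smul' r u := by ext i; simp [Finset.mul_sum]

lemma groupSum_apply (u : EuclideanSpace ℝ (ι × κ)) (i : ι) : groupSum u i = ∑ j, u (i, j) :=
  rfl

lemma groupSum_constOnGroups (c : ι → ℝ) :
    groupSum (constOnGroups κ c) = (Fintype.card κ : ℝ) • c := by
  ext i
  simp [groupSum_apply, constOnGroups_apply]

lemma groupSum_surjective [Nonempty κ] :
    Function.Surjective (groupSum : EuclideanSpace ℝ (ι × κ) →ₗ[ℝ] (ι → ℝ)) := fun c =>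
  ⟨constOnGroups κ ((Fintype.card κ : ℝ)⁻¹ • c), by
    rw [groupSum_constOnGroups, smul_inv_smul₀ (by simp)]⟩

variable (ι κ) in
/-- The space of arrays with vanishing group totals, whose projection gives the error sum of
squares. -/
noncomputable def errorSpace : Submodule ℝ (EuclideanSpace ℝ (ι × κ)) :=
  LinearMap.ker groupSum

lemma mem_errorSpace {u : EuclideanSpace ℝ (ι × κ)} : u ∈ errorSpace ι κ ↔ groupSum u = 0 :=
  LinearMap.mem_ker

lemma finrank_errorSpace [Fintype ι] [Nonempty κ] :
    finrank ℝ (errorSpace ι κ) = Fintype.card ι * (Fintype.card κ - 1) := by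
  have h := LinearMap.finrank_range_add_finrank_ker
    (groupSum : EuclideanSpace ℝ (ι × κ) →ₗ[ℝ] (ι → ℝ))
  rw [LinearMap.range_eq_top.2 groupSum_surjective, finrank_top, finrank_pi,
    finrank_euclideanSpace, Fintype.card_prod] at h
  rw [errorSpace, Nat.mul_sub_one]
  omega

end FintypeGroup

variable [Fintype ι]

variable (ι κ) in
/-- The space of arrays that are constant on groups and have total zero, whose projection gives
the sum of squares of the factor. -/
noncomputable def effectSpace : Submodule ℝ (EuclideanSpace ℝ (ι × κ)) :=
  (LinearMap.ker (∑ i, LinearMap.proj i : (ι → ℝ) →ₗ[ℝ] ℝ)).map (constOnGroups κ)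

lemma mem_effectSpace {u : EuclideanSpace ℝ (ι × κ)} :
    u ∈ effectSpace ι κ ↔ ∃ c : ι → ℝ, ∑ i, c i = 0 ∧ constOnGroups κ c = u := by
  simp [effectSpace, Submodule.mem_map]

lemma finrank_effectSpace [Nonempty κ] :
    finrank ℝ (effectSpace ι κ) = Fintype.card ι - 1 := by
  classical
  have hinj : Function.Injective (constOnGroups (ι := ι) κ) := fun c d h => by
    obtain ⟨j⟩ := ‹Nonempty κ›
    exact funext fun i => congrArg (fun u : EuclideanSpace ℝ (ι × κ) => u (i, j)) h
  rw [effectSpace, (Submodule.equivMapOfInjective _ hinj _).symm.finrank_eq]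
  rcases isEmpty_or_nonempty ι with hι | ⟨⟨i⟩⟩
  · simpa using Submodule.finrank_le (LinearMap.ker (∑ i, LinearMap.proj i : (ι → ℝ) →ₗ[ℝ] ℝ))
  · have hne : (∑ i, LinearMap.proj i : (ι → ℝ) →ₗ[ℝ] ℝ) ≠ 0 := fun h => by
      simpa using LinearMap.congr_fun h (Pi.single i 1)
    have := Dual.finrank_ker_add_one_of_ne_zero hne
    rw [finrank_pi] at this
    omega

variable [Fintype κ]

lemma inner_constOnGroups (c : ι → ℝ) (u : EuclideanSpace ℝ (ι × κ)) :
    ⟪constOnGroups κ c, u⟫ = c ⬝ᵥ groupSum u := by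
  simp [PiLp.inner_apply, Fintype.sum_prod_type, dotProduct, groupSum_apply, constOnGroups_apply,
    Finset.mul_sum, mul_comm]

lemma constOnGroups_const_mem_effectSpace_orthogonal (μ : ℝ) :
    constOnGroups κ (fun _ => μ) ∈ (effectSpace ι κ)ᗮ := by
  rw [Submodule.mem_orthogonal]
  intro u hu
  obtain ⟨c, hc, rfl⟩ := mem_effectSpace.1 hu
  simp [inner_constOnGroups, groupSum_constOnGroups, dotProduct, ← Finset.sum_mul, hc]

lemma constOnGroups_mem_errorSpace_orthogonal (c : ι → ℝ) :
    constOnGroups κ c ∈ (errorSpace ι κ)ᗮ := by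
  rw [Submodule.mem_orthogonal']
  intro u hu
  rw [inner_constOnGroups, mem_errorSpace.1 hu, dotProduct_zero]

lemma effectSpace_le_errorSpace_orthogonal : effectSpace ι κ ≤ (errorSpace ι κ)ᗮ := by
  intro u hu
  obtain ⟨c, -, rfl⟩ := mem_effectSpace.1 hu
  exact constOnGroups_mem_errorSpace_orthogonal c

lemma starProjection_errorSpace [Nonempty κ] (u : EuclideanSpace ℝ (ι × κ)) :
    (errorSpace ι κ).starProjection u
      = u - constOnGroups κ ((Fintype.card κ : ℝ)⁻¹ • groupSum u) := by
  refine Submodule.eq_starProjection_of_mem_of_inner_eq_zero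
    (K := errorSpace ι κ) ?_ fun w hw => ?_
  · rw [mem_errorSpace, map_sub, groupSum_constOnGroups, smul_inv_smul₀ (by simp), sub_self]
  · rw [sub_sub_cancel, inner_constOnGroups, mem_errorSpace.1 hw, dotProduct_zero]

lemma starProjection_effectSpace [Nonempty ι] [Nonempty κ] (u : EuclideanSpace ℝ (ι × κ)) :
    (effectSpace ι κ).starProjection u = constOnGroups κ fun i =>
      groupSum u i / Fintype.card κ
        - (∑ k, groupSum u k) / (Fintype.card ι * Fintype.card κ) := by
  refine Submodule.eq_starProjection_of_mem_of_inner_eq_zero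
    (K := effectSpace ι κ) ?_ fun w hw => ?_
  · refine mem_effectSpace.2 ⟨_, ?_, rfl⟩
    simp only [Finset.sum_sub_distrib, ← Finset.sum_div, Finset.sum_const, Finset.card_univ,
      nsmul_eq_mul]
    field_simp
    ring
  · obtain ⟨d, hd, rfl⟩ := mem_effectSpace.1 hw
    set m := (∑ k, groupSum u k) / (Fintype.card ι * Fintype.card κ)
    have hresidual (i : ι) :
        d i * (groupSum u i - Fintype.card κ * (groupSum u i / Fintype.card κ - m))
          = d i * (Fintype.card κ * m) := by field_simp; ring
    rw [real_inner_comm, inner_constOnGroups, map_sub, groupSum_constOnGroups]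
    simp only [dotProduct, Pi.sub_apply, Pi.smul_apply, smul_eq_mul, hresidual, ← Finset.sum_mul,
      hd, zero_mul]

/-- The two-way array `y` as a vector of the Euclidean space that contains `errorSpace` and
`effectSpace`. -/
noncomputable def dataVector (y : ι → κ → ℝ) : EuclideanSpace ℝ (ι × κ) :=
  WithLp.toLp 2 fun p => y p.1 p.2

variable {a n : ℕ}

lemma SSE_eq_norm_sq [NeZero n] (y : Fin a → Fin n → ℝ) :
    SSE y = ‖(errorSpace (Fin a) (Fin n)).orthogonalProjectionOnto (dataVector y)‖ ^ 2 := by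
  rw [← Submodule.norm_coe, Submodule.coe_orthogonalProjectionOnto_apply,
    starProjection_errorSpace, EuclideanSpace.real_norm_sq_eq, Fintype.sum_prod_type]
  simp [SSE, groupMean, groupSum_apply, constOnGroups_apply, dataVector, div_eq_inv_mul]

lemma SSA_eq_norm_sq [NeZero a] [NeZero n] (y : Fin a → Fin n → ℝ) :
    SSA y = ‖(effectSpace (Fin a) (Fin n)).orthogonalProjectionOnto (dataVector y)‖ ^ 2 := by
  rw [← Submodule.norm_coe, Submodule.coe_orthogonalProjectionOnto_apply,
    starProjection_effectSpace, EuclideanSpace.real_norm_sq_eq, Fintype.sum_prod_type]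
  simp [SSA, groupMean, grandMean, groupSum_apply, constOnGroups_apply, dataVector]

end TwoWayArrays

namespace RandomEffectsModel

variable {Ω : Type*} [MeasurableSpace Ω] {P : Measure Ω} {a n : ℕ} {μ : ℝ} {σsq σαsq : ℝ≥0}
  {α : Fin a → Ω → ℝ} {e y : Fin a → Fin n → Ω → ℝ}

lemma hasGaussianLaw_response (h : RandomEffectsModel P μ σsq σαsq α e y) :
    HasGaussianLaw (fun ω (p : Fin a × Fin n) => y p.1 p.2 ω) P := by
  have hjoint : HasGaussianLaw
      (fun ω s => Sum.elim α (fun p : Fin a × Fin n => e p.1 p.2) s ω) P :=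
    h.indep.hasGaussianLaw fun s => by
      rcases s with i | p
      exacts [(h.effect_law i).hasGaussianLaw, (h.error_law p.1 p.2).hasGaussianLaw]
  let L : (Fin a ⊕ Fin a × Fin n → ℝ) →L[ℝ] (Fin a × Fin n → ℝ) :=
    ContinuousLinearMap.pi fun p => ContinuousLinearMap.proj (.inl p.1)
      + ContinuousLinearMap.proj (.inr p)
  have hy : (fun ω (p : Fin a × Fin n) => y p.1 p.2 ω) = fun ω =>
      (fun _ => μ) + L fun s => Sum.elim α (fun p : Fin a × Fin n => e p.1 p.2) s ω := by
    ext ω p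
    simp [h.response, L, add_assoc]
  rw [hy]
  exact hasGaussianLaw_const_add (hjoint.map_fun L) _

lemma hasGaussianLaw_dataVector (h : RandomEffectsModel P μ σsq σαsq α e y) :
    HasGaussianLaw (fun ω => dataVector fun i j => y i j ω) P :=
  h.hasGaussianLaw_response.toLp_pi 2

lemma memLp_response (h : RandomEffectsModel P μ σsq σαsq α e y) (p : Fin a × Fin n) :
    MemLp (y p.1 p.2) 2 P :=
  (h.hasGaussianLaw_response.eval p).memLp_two

lemma memLp_effect (h : RandomEffectsModel P μ σsq σαsq α e y) (i : Fin a) : MemLp (α i) 2 P :=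
  (h.effect_law i).hasGaussianLaw.memLp_two

lemma memLp_error (h : RandomEffectsModel P μ σsq σαsq α e y) (p : Fin a × Fin n) :
    MemLp (e p.1 p.2) 2 P :=
  (h.error_law p.1 p.2).hasGaussianLaw.memLp_two

lemma integral_response (h : RandomEffectsModel P μ σsq σαsq α e y) (i : Fin a) (j : Fin n) :
    P[y i j] = μ := by
  have := h.indep.isProbabilityMeasure
  have hα : Integrable (α i) P := (h.memLp_effect i).integrable one_le_two
  have he : Integrable (e i j) P := (h.memLp_error (i, j)).integrable one_le_two
  simp only [h.response]
  rw [integral_add (by fun_prop) he, integral_add (by fun_prop) hα, (h.effect_law i).integral_eq,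
    (h.error_law i j).integral_eq]
  simp

lemma covariance_effect (h : RandomEffectsModel P μ σsq σαsq α e y) (i k : Fin a) :
    cov[α i, α k; P] = if i = k then (σαsq : ℝ) else 0 := by
  have := h.indep.isProbabilityMeasure
  split_ifs with hik
  · rw [hik, covariance_self (h.memLp_effect k).aemeasurable, (h.effect_law k).variance_eq,
      variance_id_gaussianReal]
  · exact (h.indep.indepFun (Sum.inl_injective.ne hik)).covariance_eq_zero
      (h.memLp_effect i) (h.memLp_effect k)

lemma covariance_error (h : RandomEffectsModel P μ σsq σαsq α e y) (p q : Fin a × Fin n) :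
    cov[e p.1 p.2, e q.1 q.2; P] = if p = q then (σsq : ℝ) else 0 := by
  have := h.indep.isProbabilityMeasure
  split_ifs with hpq
  · rw [hpq, covariance_self (h.memLp_error q).aemeasurable, (h.error_law q.1 q.2).variance_eq,
      variance_id_gaussianReal]
  · exact (h.indep.indepFun (Sum.inr_injective.ne hpq)).covariance_eq_zero
      (h.memLp_error p) (h.memLp_error q)

lemma covariance_effect_error (h : RandomEffectsModel P μ σsq σαsq α e y) (i : Fin a)
    (p : Fin a × Fin n) : cov[α i, e p.1 p.2; P] = 0 :=
  have := h.indep.isProbabilityMeasure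
  (h.indep.indepFun (Sum.inl_ne_inr (a := i) (b := p))).covariance_eq_zero
    (h.memLp_effect i) (h.memLp_error p)

lemma covariance_response (h : RandomEffectsModel P μ σsq σαsq α e y) (p q : Fin a × Fin n) :
    cov[y p.1 p.2, y q.1 q.2; P]
      = (if p.1 = q.1 then (σαsq : ℝ) else 0) + if p = q then (σsq : ℝ) else 0 := by
  have := h.indep.isProbabilityMeasure
  have hy (p : Fin a × Fin n) : y p.1 p.2 = fun ω => μ + (α p.1 + e p.1 p.2) ω := by
    ext ω; simp [h.response, add_assoc]
  have hα := h.memLp_effect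
  have he := h.memLp_error
  have hsum (p : Fin a × Fin n) : MemLp (α p.1 + e p.1 p.2) 2 P := (hα p.1).add (he p)
  calc cov[y p.1 p.2, y q.1 q.2; P]
      = cov[α p.1 + e p.1 p.2, α q.1 + e q.1 q.2; P] := by
        rw [hy, hy, covariance_const_add_left ((hsum p).integrable one_le_two),
          covariance_const_add_right ((hsum q).integrable one_le_two)]
    _ = cov[α p.1, α q.1; P] + cov[α p.1, e q.1 q.2; P]
          + (cov[α q.1, e p.1 p.2; P] + cov[e p.1 p.2, e q.1 q.2; P]) := by
        rw [covariance_add_left (hα p.1) (he p) (hsum q), covariance_add_right (hα _) (hα _) (he _),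
          covariance_add_right (he _) (hα _) (he _), covariance_comm (e p.1 p.2) (α q.1)]
    _ = _ := by
        rw [h.covariance_effect, h.covariance_error, h.covariance_effect_error,
          h.covariance_effect_error, add_zero, zero_add]

lemma covarianceBilin_dataVector (h : RandomEffectsModel P μ σsq σαsq α e y)
    (u v : EuclideanSpace ℝ (Fin a × Fin n)) :
    covarianceBilin (P.map fun ω => dataVector fun i j => y i j ω) u v
      = σsq * ⟪u, v⟫ + σαsq * (groupSum u ⬝ᵥ groupSum v) := by
  have := h.indep.isProbabilityMeasure
  have hcov : covarianceBilin (P.map fun ω => dataVector fun i j => y i j ω) u v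
      = ∑ p, ∑ q, u p * v q * cov[y p.1 p.2, y q.1 q.2; P] :=
    covarianceBilin_apply_pi (X := fun p : Fin a × Fin n => y p.1 p.2) h.memLp_response u v
  have herror : ∑ p, ∑ q, u p * v q * (if p = q then (σsq : ℝ) else 0) = σsq * ⟪u, v⟫ := by
    simp [PiLp.inner_apply, Finset.mul_sum, mul_comm]
  have heffect : ∑ p, ∑ q, u p * v q * (if p.1 = q.1 then (σαsq : ℝ) else 0)
      = σαsq * (groupSum u ⬝ᵥ groupSum v) := by
    simp only [dotProduct, groupSum_apply, Fintype.sum_prod_type, Finset.sum_mul_sum,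
      Finset.mul_sum (_ : Finset (Fin a))]
    refine Finset.sum_congr rfl fun i _ => ?_
    rw [Finset.mul_sum]
    refine Finset.sum_congr rfl fun j _ => ?_
    rw [Finset.sum_comm, Finset.mul_sum]
    simp [mul_comm]
  rw [hcov, ← herror, ← heffect, add_comm]
  simp only [h.covariance_response, mul_add, Finset.sum_add_distrib]

lemma integral_dataVector (h : RandomEffectsModel P μ σsq σαsq α e y) :
    ∫ ω, dataVector (fun i j => y i j ω) ∂P = constOnGroups (Fin n) fun _ => μ := by
  have := h.indep.isProbabilityMeasure
  ext p
  rw [eval_integral_piLp fun p => (h.memLp_response p).integrable one_le_two]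
  exact h.integral_response p.1 p.2

lemma covarianceBilin_dataVector_constOnGroups (h : RandomEffectsModel P μ σsq σαsq α e y)
    (c : Fin a → ℝ) (v : EuclideanSpace ℝ (Fin a × Fin n)) :
    covarianceBilin (P.map fun ω => dataVector fun i j => y i j ω) (constOnGroups (Fin n) c) v
      = (σsq + n * σαsq) * ⟪constOnGroups (Fin n) c, v⟫ := by
  rw [h.covarianceBilin_dataVector, groupSum_constOnGroups, smul_dotProduct, inner_constOnGroups,
    Fintype.card_fin, smul_eq_mul]
  ring

lemma covarianceBilin_dataVector_of_mem_errorSpace (h : RandomEffectsModel P μ σsq σαsq α e y)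
    {u v : EuclideanSpace ℝ (Fin a × Fin n)} (hu : u ∈ errorSpace (Fin a) (Fin n)) :
    covarianceBilin (P.map fun ω => dataVector fun i j => y i j ω) u v = σsq * ⟪u, v⟫ := by
  rw [h.covarianceBilin_dataVector, mem_errorSpace.1 hu, zero_dotProduct, mul_zero, add_zero]

lemma hasLaw_SSA [NeZero a] [NeZero n] (h : RandomEffectsModel P μ σsq σαsq α e y) :
    HasLaw (fun ω => SSA fun i j => y i j ω)
      (scaled (σsq + n * σαsq) (chiSquare (a - 1))) P := by
  have hmean : P[fun ω => dataVector fun i j => y i j ω] ∈ (effectSpace (Fin a) (Fin n))ᗮ :=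
    h.integral_dataVector ▸ constOnGroups_const_mem_effectSpace_orthogonal μ
  have hcov (u) (hu : u ∈ effectSpace (Fin a) (Fin n)) (v) (_ : v ∈ effectSpace (Fin a) (Fin n)) :
      covarianceBilin (P.map fun ω => dataVector fun i j => y i j ω) u v
        = (σsq + n * σαsq : ℝ≥0) * ⟪u, v⟫ := by
    obtain ⟨c, -, rfl⟩ := mem_effectSpace.1 hu
    exact_mod_cast h.covarianceBilin_dataVector_constOnGroups c v
  simpa [SSA_eq_norm_sq, finrank_effectSpace] using
    hasLaw_norm_sq_orthogonalProjectionOnto h.hasGaussianLaw_dataVector hmean hcov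

lemma hasLaw_SSE [NeZero n] (h : RandomEffectsModel P μ σsq σαsq α e y) :
    HasLaw (fun ω => SSE fun i j => y i j ω) (scaled σsq (chiSquare (a * (n - 1)))) P := by
  have hmean : P[fun ω => dataVector fun i j => y i j ω] ∈ (errorSpace (Fin a) (Fin n))ᗮ :=
    h.integral_dataVector ▸ constOnGroups_mem_errorSpace_orthogonal _
  simpa [SSE_eq_norm_sq, finrank_errorSpace] using
    hasLaw_norm_sq_orthogonalProjectionOnto h.hasGaussianLaw_dataVector hmean
      fun _ hu _ _ => h.covarianceBilin_dataVector_of_mem_errorSpace hu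

lemma indepFun_SSA_SSE [NeZero a] [NeZero n] (h : RandomEffectsModel P μ σsq σαsq α e y) :
    IndepFun (fun ω => SSA fun i j => y i j ω) (fun ω => SSE fun i j => y i j ω) P := by
  have hproj := indepFun_orthogonalProjectionOnto h.hasGaussianLaw_dataVector
    (S := errorSpace (Fin a) (Fin n)) (T := effectSpace (Fin a) (Fin n)) fun u hu v hv => by
      rw [h.covarianceBilin_dataVector_of_mem_errorSpace hu,
        Submodule.inner_right_of_mem_orthogonal hu (effectSpace_le_errorSpace_orthogonal hv),
        mul_zero]
  simp only [SSA_eq_norm_sq, SSE_eq_norm_sq]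
  exact (hproj.comp (φ := (‖·‖ ^ 2)) (ψ := (‖·‖ ^ 2)) (by fun_prop) (by fun_prop)).symm

end RandomEffectsModel

end OneWayAnova

theorem mainTheorem2 {Ω : Type*} [MeasurableSpace Ω] (P : Measure Ω) [IsProbabilityMeasure P]
    (a n : ℕ) (ha : 1 ≤ a) (hn : 1 ≤ n) (μ : ℝ) (σsq σαsq : ℝ≥0) (hσ : 0 < σsq)
    (α : Fin a → Ω → ℝ) (e y : Fin a → Fin n → Ω → ℝ)
    (hmodel : RandomEffectsModel P μ σsq σαsq α e y) :
    IndepFun (fun ω => SSA (fun i j => y i j ω)) (fun ω => SSE (fun i j => y i j ω)) P ∧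
    HasLaw (fun ω => SSA (fun i j => y i j ω))
      (scaled ((σsq : ℝ) + n * σαsq) (chiSquare (a - 1))) P ∧
    HasLaw (fun ω => SSE (fun i j => y i j ω))
      (scaled (σsq : ℝ) (chiSquare (a * (n - 1)))) P ∧
    (2 ≤ a → 2 ≤ n →
      HasLaw (fun ω => FA (fun i j => y i j ω))
        (scaled (((σsq : ℝ) + n * σαsq) / σsq) (fDist (a - 1) (a * (n - 1)))) P) := by
  have : NeZero a := ⟨by omega⟩
  have : NeZero n := ⟨by omega⟩
  have hSSA := hmodel.hasLaw_SSA
  have hSSE := hmodel.hasLaw_SSE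
  have hindep := hmodel.indepFun_SSA_SSE
  refine ⟨hindep, hSSA, hSSE, fun _ _ => ?_⟩
  refine (hasLaw_ratio_of_indepFun hindep hSSA hSSE).congr (.of_forall fun ω => ?_)
  simp only [FA, MSA, MSE, Nat.cast_mul, Nat.cast_pred ha, Nat.cast_pred hn]
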